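/- Let $k\in\mathbf N\cup\{\infty\}$. A map between open subsets of Euclidean spaces is of class $Lip^k$ if it is $C^k$ and all its derivatives of order $\le k$ are locally Lipschitz. Let $X$ be a real vector space and $X'$ a linear subspace of its algebraic dual. The $Lip^k$-structure generated by $X'$ consists of the set $\mathcal C_X$ of structure curves $c:\mathbf R\to X$ (those with $l\circ c\in Lip^k(\mathbf R,\mathbf R)$ for all $l\in X'$) and the set $\mathcal F_X$ of structure functions $f:X\to\mathbf R$ (those with $f\circ c\in Lip^k(\mathbf R,\mathbf R)$ for all $c\in\mathcal C_X$). A vector $v\in X$ is a weak derivative of $c$ at $t$ if $(l\circ c)'(t)$ exists and equals $l(v)$ for all $l\in X'$. The pair $(X,X')$ is convenient (for this $k$) if the linear elements of $\mathcal F_X$ are exactly the elements of $X'$ and every $c\in\mathcal C_X$ has exactly one weak derivative at every $t\in\mathbf R$. The diffeology $P(X)$ is the set of all plaques of $X$: an $n$-plaque ($n\in\mathbf N$) is a map $p:U\to X$ with $U\subset\mathbf R^n$ open such that $f\circ p$ is $Lip^k$ for all $f\in\mathcal F_X$. For $x\in X$ and $n\le k$, the tangent space $\mathcal T^n_xX$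 is the set of equivalence classes $[p]$ of $n$-plaques $p:U\to X$ with $0\in U$ and $p(0)=x$, where $p\sim q$ if $l\circ p$ and $l\circ q$ have the same first-order partial derivatives $\partial_1,\dots,\partial_n$ at $0$ for all $l\in X'$. Its linear structure is the one induced by the injection $[p]\mapsto (D(l\circ p)(0))_{l\in X'}$ into the vector space of all families $(\lambda_l)_{l\in X'}$ of linear forms on $\mathbf R^n$. For two such pairs $(X,X')$, $(Y,Y')$ and the same $k$, let - $D(X,Y)$ be the set of maps $f:X\to Y$ with $f\circ p\in P(Y)$ for all $p\in P(X)$; - $\mathcal M(X,Y)$ be the set of maps $f:X\to Y$ with $f\circ c\in\mathcal C_Y$ for all $c\in\mathcal C_X$; - $\mathcal C^k_l(X,Y)$ be the set of all $f\in D(X,Y)$ such that for all $x\in X$ and all $n\le k$ the map $\mathcal T^n_xX\to\mathcal T^n_{f(x)}Y$, $[p]\mapsto[f\circ p]$, is well defined and linear, in the sense that it is induced by a linear map between the vector spaces of families above. If $(X,X')$ and $(Y,Y')$ are convenient, then $$D(X,Y)=\mathcal M(X,Y)=\mathcal C^k_l(X,Y).$$ -/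

import Mathlib

open Set Filter Topology

namespace TangentDiffeology

/-! ### Maps of class `Lip^k` -/

section LipOn

variable {E F G : Type*} [NormedAddCommGroup E] [NormedSpace ℝ E]
  [NormedAddCommGroup F] [NormedSpace ℝ F] [NormedAddCommGroup G] [NormedSpace ℝ G]

/-- `f` is of class `Lip^k` on the open set `U`: it is `k` times continuously differentiable on `U`
and all its derivatives of order at most `k` are locally Lipschitz on `U`. (The sets `U` to which
this is applied are open, so only the values of `f` on `U` matter.) -/
def LipOn (k : ℕ∞) (f : E → F) (U : Set E) : Prop :=
  ContDiffOn ℝ k f U ∧ ∀ i : ℕ, (i : ℕ∞) ≤ k → LocallyLipschitzOn U (iteratedFDeriv ℝ i f)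

theorem locLip_iff_isBigO {E F : Type*} [NormedAddCommGroup E] [NormedAddCommGroup F]
    {u : E → F} {x : E} :
    (∃ K, ∃ t ∈ 𝓝 x, LipschitzOnWith K u t) ↔
      (fun a : E × E => u a.1 - u a.2) =O[𝓝 x ×ˢ 𝓝 x] fun a => a.1 - a.2 := by
  constructor
  · rintro ⟨K, t, ht, h⟩
    refine Asymptotics.IsBigO.of_bound K ?_
    filter_upwards [prod_mem_prod ht ht] with a ha
    exact h.norm_sub_le ha.1 ha.2
  · intro h
    obtain ⟨C, hC, hb⟩ := h.exists_nonneg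
    obtain ⟨t, ht, hts⟩ := mem_prod_same_iff.1 hb.bound
    refine ⟨⟨C, hC⟩, t, ht, LipschitzOnWith.of_dist_le_mul fun a ha b hb' => ?_⟩
    rw [dist_eq_norm, dist_eq_norm]
    exact hts (mk_mem_prod ha hb')

theorem locallyLipschitzOn_iff_isBigO {E F : Type*} [NormedAddCommGroup E]
    [NormedAddCommGroup F] {u : E → F} {U : Set E} (hU : IsOpen U) :
    LocallyLipschitzOn U u ↔ ∀ x ∈ U,
      (fun a : E × E => u a.1 - u a.2) =O[𝓝 x ×ˢ 𝓝 x] fun a => a.1 - a.2 := by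
  refine forall₂_congr fun x hx => ?_
  rw [← locLip_iff_isBigO, hU.nhdsWithin_eq hx]

theorem LipOn.congr {k : ℕ∞} {f g : E → F} {U : Set E} (hU : IsOpen U) (hf : LipOn k f U)
    (h : EqOn f g U) : LipOn k g U := by
  refine ⟨hf.1.congr fun x hx => (h hx).symm, fun i hi x hx => ?_⟩
  obtain ⟨K, t, ht, hL⟩ := hf.2 i hi hx
  refine ⟨K, t ∩ U, inter_mem ht self_mem_nhdsWithin, fun a ha b hb => ?_⟩
  have key : ∀ y ∈ U, iteratedFDeriv ℝ i g y = iteratedFDeriv ℝ i f y := fun y hy =>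
    (((h.symm).eventuallyEq_of_mem (hU.mem_nhds hy)).iteratedFDeriv ℝ i).eq_of_nhds
  rw [key a ha.2, key b hb.2]
  exact hL ha.1 hb.1

theorem LipOn.mono {k : ℕ∞} {f : E → F} {U V : Set E} (hf : LipOn k f U) (h : V ⊆ U) :
    LipOn k f V :=
  ⟨hf.1.mono h, fun i hi => (hf.2 i hi).mono h⟩

theorem LipOn.sUnion {k : ℕ∞} {f : E → F} {S : Set (Set E)} (hS : ∀ U ∈ S, IsOpen U)
    (h : ∀ U ∈ S, LipOn k f U) : LipOn k f (⋃₀ S) := by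
  refine ⟨fun x hx => ?_, fun i hi x hx => ?_⟩
  · obtain ⟨U, hU, hxU⟩ := hx
    exact (((h U hU).1.contDiffAt ((hS U hU).mem_nhds hxU))).contDiffWithinAt
  · obtain ⟨U, hU, hxU⟩ := hx
    obtain ⟨K, t, ht, hL⟩ := (h U hU).2 i hi hxU
    rw [(hS U hU).nhdsWithin_eq hxU] at ht
    exact ⟨K, t, mem_nhdsWithin_of_mem_nhds ht, hL⟩

theorem LipOn.of_contDiff {k : ℕ∞} {f : E → F} {U : Set E} (hf : ContDiff ℝ (⊤ : ℕ∞) f) :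
    LipOn k f U := by
  refine ⟨(hf.of_le (by exact_mod_cast le_top)).contDiffOn, fun i _ => ?_⟩
  refine LocallyLipschitz.locallyLipschitzOn ?_
  exact (hf.iteratedFDeriv_right (m := 1) (i := i) (by exact_mod_cast le_top)).locallyLipschitz

theorem LipOn.isBigO {k : ℕ∞} {f : E → F} {U : Set E} (hU : IsOpen U) (hf : LipOn k f U)
    {x : E} (hx : x ∈ U) :
    (fun a : E × E => f a.1 - f a.2) =O[𝓝 x ×ˢ 𝓝 x] fun a => a.1 - a.2 := by
  obtain ⟨K, t, ht, hL⟩ := hf.2 0 (by simp) hx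
  rw [hU.nhdsWithin_eq hx] at ht
  refine locLip_iff_isBigO.1 ⟨K, t, ht, LipschitzOnWith.of_dist_le_mul fun a ha b hb => ?_⟩
  have := hL.dist_le_mul a ha b hb
  rwa [iteratedFDeriv_zero_eq_comp, Function.comp_apply, Function.comp_apply,
    LinearIsometryEquiv.dist_map] at this

theorem LipOn.comp {k : ℕ∞} {g : F → G} {f : E → F} {U : Set F} {V : Set E} (hU : IsOpen U)
    (hV : IsOpen V) (hg : LipOn k g U) (hf : LipOn k f V) (h : MapsTo f V U) :
    LipOn k (g ∘ f) V := by
  refine ⟨hg.1.comp hf.1 h, fun i hi => ?_⟩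
  rw [locallyLipschitzOn_iff_isBigO hV]
  intro x hx
  have hfx : ContinuousAt f x := hf.1.continuousOn.continuousAt (hV.mem_nhds hx)
  have h1 : Tendsto (fun a : E × E => a.1) (𝓝 x ×ˢ 𝓝 x) (𝓝 x) := tendsto_fst
  have h2 : Tendsto (fun a : E × E => a.2) (𝓝 x ×ˢ 𝓝 x) (𝓝 x) := tendsto_snd
  have hi' : ∀ {j : ℕ}, j ≤ i → (j : ℕ∞) ≤ k := fun hj => le_trans (by exact_mod_cast hj) hi
  have hkw : ∀ {j : ℕ}, j ≤ i → (j : WithTop ℕ∞) ≤ k := fun hj => by exact_mod_cast hi' hj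
  have cg : ∀ j ≤ i, ContinuousAt (iteratedFDeriv ℝ j g) (f x) := fun j hj =>
    ((hg.2 j (hi' hj)).continuousOn).continuousAt (hU.mem_nhds (h hx))
  have cf : ∀ j ≤ i, ContinuousAt (iteratedFDeriv ℝ j f) x := fun j hj =>
    ((hf.2 j (hi' hj)).continuousOn).continuousAt (hV.mem_nhds hx)
  have key := FormalMultilinearSeries.taylorComp_sub_taylorComp_isBigO
    (𝕜 := ℝ) (l := 𝓝 x ×ˢ 𝓝 x) (n := i)
    (p₁ := fun a : E × E => ftaylorSeries ℝ g (f a.1))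
    (p₂ := fun a : E × E => ftaylorSeries ℝ g (f a.2))
    (q₁ := fun a : E × E => ftaylorSeries ℝ f a.1)
    (q₂ := fun a : E × E => ftaylorSeries ℝ f a.2)
    (f := fun a : E × E => ‖a.1 - a.2‖)
    (fun j hj => ((cg j hj).tendsto.comp (hfx.tendsto.comp h1)).norm.isBoundedUnder_le)
    (fun j hj => by
      have hb := (locallyLipschitzOn_iff_isBigO hU).1 (hg.2 j (hi' hj)) (f x) (h hx)
      have := hb.comp_tendsto ((hfx.tendsto.comp h1).prodMk (hfx.tendsto.comp h2))
      exact (this.trans (LipOn.isBigO hV hf hx)).norm_right)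
    (fun j hj => ((cf j hj).tendsto.comp h1).norm.isBoundedUnder_le)
    (fun j hj => ((cf j hj).tendsto.comp h2).norm.isBoundedUnder_le)
    (fun j hj =>
      ((locallyLipschitzOn_iff_isBigO hV).1 (hf.2 j (hi' hj)) x hx).norm_right)
  have ev : ∀ᶠ a : E × E in 𝓝 x ×ˢ 𝓝 x, a ∈ V ×ˢ V :=
    prod_mem_prod (hV.mem_nhds hx) (hV.mem_nhds hx)
  have eqd : ∀ y ∈ V, iteratedFDeriv ℝ i (g ∘ f) y =
      (ftaylorSeries ℝ g (f y)).taylorComp (ftaylorSeries ℝ f y) i := fun y hy =>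
    iteratedFDeriv_comp (hg.1.contDiffAt (hU.mem_nhds (h hy)))
      (hf.1.contDiffAt (hV.mem_nhds hy)) (hkw le_rfl)
  refine (key.norm_right.congr' ?_ ?_).of_norm_right
  · filter_upwards [ev] with a ha
    rw [eqd _ ha.1, eqd _ ha.2]
  · filter_upwards with a
    simp

end LipOn

/-! ### Structures determined by curves and functions -/

/-- `Lip^k(ℝ, ℝ)`. -/
def lipFun (k : ℕ∞) : Set (ℝ → ℝ) := {h | LipOn k h univ}

/-- The functions on `X` determined by a set of curves. -/
def functionsOf (M : Set (ℝ → ℝ)) {X : Type*} (C : Set (ℝ → X)) : Set (X → ℝ) :=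
  {f | ∀ c ∈ C, f ∘ c ∈ M}

/-- The curves in `X` determined by a set of functions. -/
def curvesOf (M : Set (ℝ → ℝ)) {X : Type*} (F : Set (X → ℝ)) : Set (ℝ → X) :=
  {c | ∀ f ∈ F, f ∘ c ∈ M}

/-- An `M`-structure on `X`: a set of curves and a set of functions that determine each other. -/
structure MStructure (M : Set (ℝ → ℝ)) (X : Type*) where
  curves : Set (ℝ → X)
  functions : Set (X → ℝ)
  functionsOf_curves : functionsOf M curves = functions
  curvesOf_functions : curvesOf M functions = curves

/-- The `M`-structure generated by a set of functions. -/
def MStructure.generate (M : Set (ℝ → ℝ)) {X : Type*} (F₀ : Set (X → ℝ)) : MStructure M X where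
  curves := curvesOf M F₀
  functions := functionsOf M (curvesOf M F₀)
  functionsOf_curves := rfl
  curvesOf_functions := Subset.antisymm
    (fun _ hc f hf => hc f fun _ hd => hd f hf) (fun c hc _ hf => hf c hc)

/-- The set `M(X, Y)` of `M`-maps. -/
def MStructure.maps {M : Set (ℝ → ℝ)} {X Y : Type*} (A : MStructure M X) (B : MStructure M Y) :
    Set (X → Y) :=
  {h | ∀ c ∈ A.curves, h ∘ c ∈ B.curves}

/-! ### Diffeologies of class `Lip^k` -/

/-- The Euclidean space `ℝⁿ`. -/
abbrev Euc (n : ℕ) : Type := EuclideanSpace ℝ (Fin n)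

/-- A diffeology on `X` with respect to the class of all `Lip^k` maps between open subsets of
Euclidean spaces. An `n`-plaque is a map `p : U → X` on an open set `U ⊆ ℝⁿ`; it is represented by
`U` together with a function on `ℝⁿ` whose values outside `U` are irrelevant (`congr`). -/
structure LipDiffeology (k : ℕ∞) (X : Type*) where
  IsPlaque : ∀ {n : ℕ}, Set (Euc n) → (Euc n → X) → Prop
  isOpen : ∀ {n : ℕ} {U : Set (Euc n)} {p : Euc n → X}, IsPlaque U p → IsOpen U
  congr : ∀ {n : ℕ} {U : Set (Euc n)} {p q : Euc n → X}, IsPlaque U p → EqOn p q U → IsPlaque U q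
  cover : ∀ x : X, ∃ (n : ℕ) (U : Set (Euc n)) (p : Euc n → X), IsPlaque U p ∧ x ∈ p '' U
  glue : ∀ {n : ℕ} (S : Set (Set (Euc n))) (p : Euc n → X),
    (∀ U ∈ S, IsPlaque U p) → IsPlaque (⋃₀ S) p
  comp : ∀ {m n : ℕ} {U' : Set (Euc m)} {U : Set (Euc n)} {φ : Euc m → Euc n} {p : Euc n → X},
    IsOpen U' → LipOn k φ U' → MapsTo φ U' U → IsPlaque U p → IsPlaque U' (p ∘ φ)

namespace LipDiffeology

variable {k : ℕ∞} {X Y : Type*}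

/-- The set `D(X, Y)` of morphisms of diffeological spaces. -/
def morphisms (P : LipDiffeology k X) (Q : LipDiffeology k Y) : Set (X → Y) :=
  {f | ∀ (n : ℕ) (U : Set (Euc n)) (p : Euc n → X), P.IsPlaque U p → Q.IsPlaque U (f ∘ p)}

variable (k) in
/-- The standard diffeology on `ℝ`. -/
def standard : LipDiffeology k ℝ where
  IsPlaque U p := IsOpen U ∧ LipOn k p U
  isOpen h := h.1
  congr h hpq := ⟨h.1, h.2.congr h.1 hpq⟩
  cover x := ⟨0, univ, fun _ => x, ⟨isOpen_univ, LipOn.of_contDiff contDiff_const⟩, 0, trivial, rfl⟩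
  glue _ _ h := ⟨isOpen_sUnion fun U hU => (h U hU).1,
    LipOn.sUnion (fun U hU => (h U hU).1) fun U hU => (h U hU).2⟩
  comp hU' hφ hm h := ⟨hU', LipOn.comp h.1 hU' h.2 hφ hm⟩

/-- The diffeology defined by a `Lip^k`-structure: its plaques are the maps `p` such that `f ∘ p`
is `Lip^k` for every structure function `f`. -/
def ofMStructure (A : MStructure (lipFun k) X) : LipDiffeology k X where
  IsPlaque U p := IsOpen U ∧ ∀ f ∈ A.functions, LipOn k (f ∘ p) U
  isOpen h := h.1
  congr h hpq := ⟨h.1, fun f hf => (h.2 f hf).congr h.1 fun x hx => congrArg f (hpq hx)⟩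
  cover x := ⟨0, univ, fun _ => x,
    ⟨isOpen_univ, fun f _ => LipOn.of_contDiff (contDiff_const (c := f x))⟩, 0, trivial, rfl⟩
  glue _ _ h := ⟨isOpen_sUnion fun U hU => (h U hU).1,
    fun f hf => LipOn.sUnion (fun U hU => (h U hU).1) fun U hU => (h U hU).2 f hf⟩
  comp hU' hφ hm h := ⟨hU', fun f hf => by
    have := LipOn.comp h.1 hU' (h.2 f hf) hφ hm
    rwa [Function.comp_assoc] at this⟩

/-- The `n`-plaques through the point `x`, normalized so that `0` is in the domain and is mapped
to `x`. -/
structure PlaqueAt (P : LipDiffeology k X) (n : ℕ) (x : X) where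
  dom : Set (Euc n)
  toFun : Euc n → X
  isPlaque : P.IsPlaque dom toFun
  zero_mem : 0 ∈ dom
  map_zero : toFun 0 = x

/-- `p ∘ φ` as a plaque through the same point, for `φ` with `φ 0 = 0`. -/
def PlaqueAt.comp {P : LipDiffeology k X} {m n : ℕ} {x : X} (p : P.PlaqueAt n x) (φ : Euc m → Euc n)
    (U' : Set (Euc m)) (hU' : IsOpen U') (hφ : LipOn k φ U') (h0 : 0 ∈ U') (hφ0 : φ 0 = 0)
    (hm : MapsTo φ U' p.dom) : P.PlaqueAt m x where
  dom := U'
  toFun := p.toFun ∘ φ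
  isPlaque := P.comp hU' hφ hm p.isPlaque
  zero_mem := h0
  map_zero := by rw [Function.comp_apply, hφ0, p.map_zero]

/-- `f ∘ p` as a plaque through `f x`. -/
def PlaqueAt.map {P : LipDiffeology k X} {Q : LipDiffeology k Y} {n : ℕ} {x : X} (p : P.PlaqueAt n x)
    {f : X → Y} (hf : f ∈ P.morphisms Q) : Q.PlaqueAt n (f x) where
  dom := p.dom
  toFun := f ∘ p.toFun
  isPlaque := hf n _ _ p.isPlaque
  zero_mem := p.zero_mem
  map_zero := by rw [Function.comp_apply, p.map_zero]

end LipDiffeology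

/-! ### Tangent structures -/

/-- A tangent structure on a diffeological space: for each point `x` and each `n ≤ k` an
equivalence relation on the `n`-plaques through `x`, compatible with `Lip^k` changes of parameters
and with restrictions to smaller neighbourhoods of `0`. (The values of `rel n` for `n > k` are
irrelevant: they are not used.) -/
structure TangentStructure {k : ℕ∞} {X : Type*} (P : LipDiffeology k X) where
  rel : ∀ (n : ℕ) (x : X), Setoid (P.PlaqueAt n x)
  comp : ∀ {m n : ℕ}, (m : ℕ∞) ≤ k → (n : ℕ∞) ≤ k → ∀ {x : X} (p q : P.PlaqueAt n x)
    (φ : Euc m → Euc n) (U' : Set (Euc m)) (hU' : IsOpen U') (hφ : LipOn k φ U') (h0 : 0 ∈ U')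
    (hφ0 : φ 0 = 0) (hp : MapsTo φ U' p.dom) (hq : MapsTo φ U' q.dom), rel n x p q →
    rel m x (p.comp φ U' hU' hφ h0 hφ0 hp) (q.comp φ U' hU' hφ h0 hφ0 hq)
  restrict : ∀ {n : ℕ}, (n : ℕ∞) ≤ k → ∀ {x : X} (p q : P.PlaqueAt n x),
    q.dom ⊆ p.dom → EqOn p.toFun q.toFun q.dom → rel n x p q

namespace TangentStructure

variable {k : ℕ∞} {X Y : Type*} {P : LipDiffeology k X} {Q : LipDiffeology k Y}

/-- The `n`-th tangent space at `x`. -/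
def TangentSpace (T : TangentStructure P) (n : ℕ) (x : X) : Type _ := Quotient (T.rel n x)

/-- The differentiable maps: the morphisms that preserve the equivalence of plaques. -/
def differentiableMaps (T : TangentStructure P) (S : TangentStructure Q) : Set (X → Y) :=
  {f | ∃ hf : f ∈ P.morphisms Q, ∀ n : ℕ, (n : ℕ∞) ≤ k → ∀ (x : X) (p q : P.PlaqueAt n x),
    T.rel n x p q → S.rel n (f x) (p.map hf) (q.map hf)}

/-- The map `[p] ↦ [f ∘ p]` induced on tangent spaces. -/
def tangentMap {T : TangentStructure P} {S : TangentStructure Q} {f : X → Y}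
    (hf : f ∈ T.differentiableMaps S) (n : ℕ) (hn : (n : ℕ∞) ≤ k) (x : X) :
    T.TangentSpace n x → S.TangentSpace n (f x) :=
  Quotient.map (sa := T.rel n x) (sb := S.rel n (f x)) (fun p => p.map hf.1)
    (fun p q h => hf.2 n hn x p q h)

end TangentStructure

section Canonical

open LipDiffeology

variable {k : ℕ∞} {X Y : Type*} {P : LipDiffeology k X} {Q : LipDiffeology k Y}

/-- The family, indexed by `f ∈ 𝓕`, of the differentials at `0` of the functions `f ∘ p`, that is,
of the tuples `(∂₁(f ∘ p)(0), …, ∂ₙ(f ∘ p)(0))` of partial derivatives. -/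
noncomputable def differentials (𝓕 : Set (X → ℝ)) {n : ℕ} {x : X} (p : P.PlaqueAt n x) :
    𝓕 → (Euc n →L[ℝ] ℝ) :=
  fun f => fderiv ℝ (f.1 ∘ p.toFun) 0

theorem differentials_comp {𝓕 : Set (X → ℝ)} (h𝓕 : 𝓕 ⊆ P.morphisms (standard k)) {m n : ℕ}
    (hm : (m : ℕ∞) ≤ k) {x : X} (p : P.PlaqueAt n x) (φ : Euc m → Euc n) (U' : Set (Euc m))
    (hU' : IsOpen U') (hφ : LipOn k φ U') (h0 : 0 ∈ U') (hφ0 : φ 0 = 0)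
    (hp : MapsTo φ U' p.dom) (f : 𝓕) :
    differentials 𝓕 (p.comp φ U' hU' hφ h0 hφ0 hp) f =
      (differentials 𝓕 p f).comp (fderiv ℝ φ 0) := by
  rcases Nat.eq_zero_or_pos m with rfl | hm0
  · ext v
    rw [Subsingleton.elim v 0, map_zero, map_zero]
  have hk : (k : WithTop ℕ∞) ≠ 0 := by
    rintro hk
    have : k = 0 := by exact_mod_cast hk
    rw [this] at hm
    have : m = 0 := by simpa using hm
    omega
  have hfp := (h𝓕 f.2 n _ _ p.isPlaque).2.1
  have d1 : DifferentiableAt ℝ (f.1 ∘ p.toFun) (φ 0) := by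
    rw [hφ0]
    exact (hfp.contDiffAt ((P.isOpen p.isPlaque).mem_nhds p.zero_mem)).differentiableAt hk
  have d2 : DifferentiableAt ℝ φ 0 := (hφ.1.contDiffAt (hU'.mem_nhds h0)).differentiableAt hk
  have := fderiv_comp (0 : Euc m) d1 d2
  rw [hφ0] at this
  exact this

/-- The canonical tangent structure defined by a set `𝓕` of differentiable functions: two
`n`-plaques `p, q` through `x` are equivalent if `f ∘ p` and `f ∘ q` have the same partial
derivatives at `0` for all `f ∈ 𝓕`. -/
noncomputable def TangentStructure.canonical (P : LipDiffeology k X) (𝓕 : Set (X → ℝ))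
    (h𝓕 : 𝓕 ⊆ P.morphisms (standard k)) : TangentStructure P where
  rel n x := Setoid.ker (differentials (P := P) (n := n) (x := x) 𝓕)
  comp := by
    intro m n hm _ x p q φ U' hU' hφ h0 hφ0 hp hq h
    rw [Setoid.ker_def] at h ⊢
    funext f
    rw [differentials_comp h𝓕 hm, differentials_comp h𝓕 hm, h]
  restrict := by
    intro n _ x p q hd he
    rw [Setoid.ker_def]
    funext f
    refine Filter.EventuallyEq.fderiv_eq ?_
    filter_upwards [(P.isOpen q.isPlaque).mem_nhds q.zero_mem] with y hy
    exact congrArg f.1 (he hy)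

/-- The injection of a tangent space of a canonical tangent structure into the vector space of all
families, indexed by `𝓕`, of linear forms on `ℝⁿ`. The linear structure of the tangent space is
the one induced by this injection: `[p₁₂] = [p₁] + [p₂]` means that
`D(f ∘ p₁₂)(0) = D(f ∘ p₁)(0) + D(f ∘ p₂)(0)` for all `f ∈ 𝓕`, and `c [p]` is the class of
`t ↦ p (c t)`, that is, the class with the differentials `c D(f ∘ p)(0)`. -/
noncomputable def tangentVector {𝓕 : Set (X → ℝ)} {h𝓕 : 𝓕 ⊆ P.morphisms (standard k)} {n : ℕ}
    {x : X} : (TangentStructure.canonical P 𝓕 h𝓕).TangentSpace n x → (𝓕 → (Euc n →L[ℝ] ℝ)) :=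
  Quotient.lift (s := (TangentStructure.canonical P 𝓕 h𝓕).rel n x) (differentials 𝓕)
    (fun _ _ h => h)

/-- The set `C_l^k(X, Y)` of `C^k`-maps between canonical tangent diffeological spaces: the
differentiable maps `f` for which all the induced maps `[p] ↦ [f ∘ p]` of tangent spaces are
linear, the tangent spaces being regarded as subsets of vector spaces through `tangentVector`
(a map from a linear subspace is linear if and only if it is the restriction of a linear map that
is defined everywhere). -/
def cMaps {𝓕 : Set (X → ℝ)} (h𝓕 : 𝓕 ⊆ P.morphisms (standard k)) {𝓖 : Set (Y → ℝ)}
    (h𝓖 : 𝓖 ⊆ Q.morphisms (standard k)) : Set (X → Y) :=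
  {f | ∃ hf : f ∈ (TangentStructure.canonical P 𝓕 h𝓕).differentiableMaps
      (TangentStructure.canonical Q 𝓖 h𝓖),
    ∀ (n : ℕ) (hn : (n : ℕ∞) ≤ k) (x : X),
      ∃ L : (𝓕 → (Euc n →L[ℝ] ℝ)) →ₗ[ℝ] (𝓖 → (Euc n →L[ℝ] ℝ)),
        ∀ t : (TangentStructure.canonical P 𝓕 h𝓕).TangentSpace n x,
          L (tangentVector t) = tangentVector (TangentStructure.tangentMap hf n hn x t)}

end Canonical

/-! ### Convenient spaces

A dual vector space is a real vector space `X` with a subspace `X'` of its algebraic dual. -/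

section Convenient

variable {X : Type*} [AddCommGroup X] [Module ℝ X]

/-- The elements of `X'`, regarded as functions on `X`. -/
def dualFunctions (X' : Submodule ℝ (Module.Dual ℝ X)) : Set (X → ℝ) := {f | ∃ l ∈ X', f = ⇑l}

/-- The `Lip^k`-structure generated by `X'`. -/
def lipStructure (k : ℕ∞) (X' : Submodule ℝ (Module.Dual ℝ X)) : MStructure (lipFun k) X :=
  MStructure.generate (lipFun k) (dualFunctions X')

/-- `v` is a weak derivative of `c` at `t`. -/
def IsWeakDerivAt (X' : Submodule ℝ (Module.Dual ℝ X)) (c : ℝ → X) (v : X) (t : ℝ) : Prop :=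
  ∀ l ∈ X', HasDerivAt (fun s => l (c s)) (l v) t

/-- `(X, X')` is preconvenient: the linear structure functions of the `Lip^k`-structure generated by
`X'` are exactly the elements of `X'`. -/
def IsPreconvenient (k : ℕ∞) (X' : Submodule ℝ (Module.Dual ℝ X)) : Prop :=
  ∀ l : Module.Dual ℝ X, ⇑l ∈ (lipStructure k X').functions ↔ l ∈ X'

/-- `(X, X')` is convenient: it is preconvenient, every `Lip^k`-curve has at most one weak
derivative at each point (separatedness), and every `Lip^k`-curve has a weak derivative at each
point (completeness). -/
structure IsConvenient (k : ℕ∞) (X' : Submodule ℝ (Module.Dual ℝ X)) : Prop where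
  preconvenient : IsPreconvenient k X'
  separated : ∀ c ∈ (lipStructure k X').curves, ∀ (t : ℝ) (v w : X),
    IsWeakDerivAt X' c v t → IsWeakDerivAt X' c w t → v = w
  complete : ∀ c ∈ (lipStructure k X').curves, ∀ t : ℝ, ∃ v : X, IsWeakDerivAt X' c v t

/-- The diffeology of a dual vector space: the one defined by its `Lip^k`-structure. -/
def diffeology (k : ℕ∞) (X' : Submodule ℝ (Module.Dual ℝ X)) : LipDiffeology k X :=
  LipDiffeology.ofMStructure (lipStructure k X')

theorem dualFunctions_subset (k : ℕ∞) (X' : Submodule ℝ (Module.Dual ℝ X)) :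
    dualFunctions X' ⊆ (diffeology k X').morphisms (LipDiffeology.standard k) :=
  fun f hf _ _ _ (hp : IsOpen _ ∧ _) => ⟨hp.1, hp.2 f fun _ hc => hc f hf⟩

end Convenient

end TangentDiffeology

namespace TangentDiffeology

/-! ### Curves assembled from disjoint bumps that accumulate at `0`. -/

section SpecialCurves

variable {X : Type*} [AddCommGroup X] [Module ℝ X]

/-! The equality of plaque morphisms and `M`-maps is formal. Both kinds of map pull structure
functions back to structure functions, and a curve is the same thing as a 1-plaque on the line.

The content is linearity on tangent spaces. For `n = 0` there is nothing to prove, so let `k ≥ 1`.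
Two facts about a structure function `g` carry the argument: along a curve, the derivative of `g ∘
c` depends only on the weak derivative of `c` (`deriv_comp_curve`), and the directional derivative
of `g` at a point is additive in the direction (`deriv_line_add`). No topology on `X` is at hand, so
each is tested on one special curve, a series of bumps near the points `2⁻ⁿ`. Since `g` composed
with that curve is `C¹` with locally Lipschitz derivative, the difference quotients encoded in the
bumps are controlled in the limit.

Hence, by completeness of `X`, a plaque `p` at `x` has a linear "differential" `A : ℝⁿ → X` with
`D(g ∘ p)(0) = dg(x) ∘ A` for every structure function `g`. Taking `g` in `X'` gives the tangent
vector of `p`, and taking `g = l ∘ f` with `l` in `Y'` gives that of `f ∘ p`. Both depend linearly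
on `A`, and by separatedness the first determines `A`. So the second is a linear function of the
first. -/

theorem summable_pow_div_pow {ρ : ℕ → ℝ} (hρ : ∀ n, 0 < ρ n) (hρ' : ∀ n, ρ n ≤ (1 / 2) ^ (n + 2))
    (j : ℕ) : Summable fun n => ρ n ^ n / ρ n ^ j := by
  -- After dropping `j` terms the powers of `ρ` partly cancel, leaving `ρ (n + j) ^ n ≤ (1 / 2) ^
  -- n`.
  rw [← summable_nat_add_iff j]
  refine Summable.of_nonneg_of_le (fun n => ?_) (fun n => ?_)
    (summable_geometric_of_lt_one (r := (1 / 2 : ℝ)) (by norm_num) (by norm_num))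
  · have := hρ (n + j)
    positivity
  · rw [pow_add, mul_div_assoc, div_self (pow_ne_zero _ (hρ _).ne'), mul_one]
    refine pow_le_pow_left₀ (hρ _).le ((hρ' _).trans ?_) n
    exact pow_le_of_le_one (by norm_num) (by norm_num) (by omega)

/-- The series of the bumps `κ n * Θ ((t - 2⁻ⁿ) / ρ n)` in the directions `u n`. -/
noncomputable def bumpSeries (Θ : ℝ → ℝ) (κ ρ : ℕ → ℝ) (u : ℕ → X) (t : ℝ) : X :=
  ∑ᶠ n, (κ n * Θ ((t - (1 / 2) ^ n) / ρ n)) • u n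

/-- For `m < n` the centres are at least `2⁻ᵐ / 2` apart, more than the sum of the radii. So at most
one bump is active at any `t`. -/
theorem eq_of_abs_sub_half_pow_lt {t : ℝ} {m n : ℕ} (hm : |t - (1 / 2) ^ m| < (1 / 2) ^ (m + 2))
    (hn : |t - (1 / 2) ^ n| < (1 / 2) ^ (n + 2)) : m = n := by
  wlog h : m < n generalizing m n with H
  · rcases (not_lt.1 h).eq_or_lt with h | h
    · exact h.symm
    · exact (H hn hm h).symm
  have h1 : (1 / 2 : ℝ) ^ n ≤ (1 / 2) ^ (m + 1) :=
    pow_le_pow_of_le_one (by norm_num) (by norm_num) h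
  have h2 : (0 : ℝ) < (1 / 2) ^ m := by positivity
  rw [pow_succ] at h1
  rw [abs_lt, pow_add] at hm hn
  exfalso
  linarith [hm.1, hn.2]

variable {Θ : ℝ → ℝ} {κ ρ : ℕ → ℝ} {u : ℕ → X}

theorem bump_eq_zero (hΘ : ∀ y, 1 ≤ |y| → Θ y = 0) (hρ : ∀ n, 0 < ρ n) {t : ℝ} {n : ℕ}
    (h : ρ n ≤ |t - (1 / 2) ^ n|) : Θ ((t - (1 / 2) ^ n) / ρ n) = 0 := by
  refine hΘ _ ?_
  rwa [abs_div, abs_of_pos (hρ n), one_le_div (hρ n)]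

theorem bumpSeries_eq (hΘ : ∀ y, 1 ≤ |y| → Θ y = 0) (hρ : ∀ n, 0 < ρ n)
    (hρ' : ∀ n, ρ n ≤ (1 / 2) ^ (n + 2)) {t : ℝ} {n : ℕ}
    (h : |t - (1 / 2) ^ n| < (1 / 2) ^ (n + 2)) :
    bumpSeries Θ κ ρ u t = (κ n * Θ ((t - (1 / 2) ^ n) / ρ n)) • u n := by
  refine finsum_eq_single _ n fun m hm => ?_
  rw [bump_eq_zero hΘ hρ, mul_zero, zero_smul]
  by_contra! h'
  exact hm (eq_of_abs_sub_half_pow_lt (h'.trans_le (hρ' m)) h)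

theorem exists_norm_iteratedDeriv_le (hΘ : ∀ y, 1 ≤ |y| → Θ y = 0) (hΘ' : ContDiff ℝ (⊤ : ℕ∞) Θ)
    (j : ℕ) : ∃ C, ∀ y, ‖iteratedDeriv j Θ y‖ ≤ C := by
  have hc : HasCompactSupport Θ := by
    refine HasCompactSupport.intro (isCompact_closedBall (0 : ℝ) 1) fun y hy => hΘ y ?_
    rw [mem_closedBall_zero_iff, Real.norm_eq_abs] at hy
    exact (not_le.1 hy).le
  have hcont : Continuous (iteratedFDeriv ℝ j Θ) :=
    hΘ'.continuous_iteratedFDeriv (by exact_mod_cast le_top)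
  obtain ⟨C, hC⟩ := (hc.iteratedFDeriv (𝕜 := ℝ) j).exists_bound_of_continuous hcont
  refine ⟨C, fun y => ?_⟩
  rw [← norm_iteratedFDeriv_eq_norm_iteratedDeriv]
  exact hC y

/-- Rescaling by `ρ n` costs a factor `ρ n ^ (-j)` in the `j`-th derivative, but the coefficients
decay like `ρ n ^ n`, which beats every fixed power. The directions need only be bounded under each
form `l` separately. -/
theorem contDiff_bumpSeries (hΘ : ∀ y, 1 ≤ |y| → Θ y = 0) (hρ : ∀ n, 0 < ρ n)
    (hρ' : ∀ n, ρ n ≤ (1 / 2) ^ (n + 2)) (hΘ' : ContDiff ℝ (⊤ : ℕ∞) Θ)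
    (hκ : ∀ n, |κ n| ≤ ρ n ^ n) (l : Module.Dual ℝ X) (hl : ∃ M, ∀ n, |l (u n)| ≤ M) :
    ContDiff ℝ (⊤ : ℕ∞) fun t => l (bumpSeries Θ κ ρ u t) := by
  have hfin : ∀ t, {n | Θ ((t - (1 / 2) ^ n) / ρ n) ≠ 0}.Finite := fun t => by
    refine Set.Subsingleton.finite fun m hm n hn => ?_
    refine eq_of_abs_sub_half_pow_lt (t := t) ?_ ?_
    · by_contra! h
      exact hm (bump_eq_zero hΘ hρ ((hρ' m).trans h))
    · by_contra! h
      exact hn (bump_eq_zero hΘ hρ ((hρ' n).trans h))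
  have heq : (fun t => l (bumpSeries Θ κ ρ u t)) =
      fun t => ∑' n, (l (u n) * κ n) * Θ ((ρ n)⁻¹ * (t - (1 / 2) ^ n)) := by
    funext t
    rw [bumpSeries, map_finsum, tsum_eq_finsum]
    · refine finsum_congr fun n => ?_
      rw [map_smul, smul_eq_mul, div_eq_inv_mul]
      ring
    · refine (hfin t).subset fun n hn h => hn ?_
      rw [div_eq_inv_mul] at h
      exact mul_eq_zero_of_right _ h
    · refine (hfin t).subset fun n hn h => hn ?_
      change (_ * _) • _ = (0 : X)
      rw [h, mul_zero, zero_smul]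
  obtain ⟨M, hM⟩ := hl
  have hbd := fun j => exists_norm_iteratedDeriv_le hΘ hΘ' j
  choose C hC using hbd
  rw [heq]
  have hs : ∀ n, ContDiff ℝ (⊤ : ℕ∞) fun t => Θ ((ρ n)⁻¹ * (t - (1 / 2) ^ n)) := fun n =>
    hΘ'.comp (contDiff_const.mul (contDiff_id.sub contDiff_const))
  refine contDiff_tsum (v := fun j n => M * C j * (ρ n ^ n / ρ n ^ j))
    (fun n => contDiff_const.mul (hs n)) (fun j _ => (summable_pow_div_pow hρ hρ' j).mul_left _)
    fun j n t _ => ?_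
  rw [norm_iteratedFDeriv_eq_norm_iteratedDeriv, iteratedDeriv_const_mul_field,
    iteratedDeriv_comp_sub_const (f := fun s => Θ ((ρ n)⁻¹ * s)),
    iteratedDeriv_comp_const_mul (hΘ'.of_le (by exact_mod_cast le_top))]
  have h1 := hC j ((ρ n)⁻¹ * (t - (1 / 2) ^ n))
  have h0 := hρ n
  have hM0 : 0 ≤ M := (abs_nonneg _).trans (hM 0)
  rw [norm_mul, norm_mul, norm_mul, norm_pow, norm_inv, Real.norm_of_nonneg h0.le,
    Real.norm_eq_abs, Real.norm_eq_abs]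
  calc _ ≤ (M * ρ n ^ n) * ((ρ n)⁻¹ ^ j * C j) := by
        gcongr
        · exact hM n
        · exact hκ n
    _ = _ := by
        rw [inv_pow]
        ring

end SpecialCurves
-- `Lip^k` functions of one real variable.
section DirectionalDerivatives

theorem LipOn.contDiff_one {k : ℕ∞} (hk : k ≠ 0) {h : ℝ → ℝ} (hh : LipOn k h univ) :
    ContDiff ℝ 1 h :=
  (contDiffOn_univ.1 hh.1).of_le (by exact_mod_cast Order.one_le_iff_ne_zero.2 hk)

theorem LipOn.locallyLipschitz_deriv {k : ℕ∞} (hk : k ≠ 0) {h : ℝ → ℝ} (hh : LipOn k h univ)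
    (x : ℝ) : ∃ K : ℝ, ∃ t ∈ 𝓝 x, ∀ a ∈ t, ∀ b ∈ t, |deriv h a - deriv h b| ≤ K * |a - b| := by
  obtain ⟨K, t, ht, hL⟩ := hh.2 1 (by exact_mod_cast Order.one_le_iff_ne_zero.2 hk) (mem_univ x)
  rw [nhdsWithin_univ] at ht
  refine ⟨K, t, ht, fun a ha b hb => ?_⟩
  have h1 : ∀ y, deriv h y = iteratedFDeriv ℝ 1 h y fun _ => 1 := fun y => by
    rw [← iteratedDeriv_one, iteratedDeriv_eq_iteratedFDeriv]
  rw [h1, h1, ← sub_apply, ← Real.norm_eq_abs, ← Real.norm_eq_abs]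
  refine ((iteratedFDeriv ℝ 1 h a - iteratedFDeriv ℝ 1 h b).le_opNorm _).trans ?_
  simpa using hL.norm_sub_le ha hb

/-- A function with Lipschitz derivative agrees with its affine approximation up to second order. -/
theorem LipOn.exists_abs_sub_le_sq {k : ℕ∞} (hk : k ≠ 0) {h : ℝ → ℝ} (hh : LipOn k h univ) :
    ∃ K : ℝ, ∀ᶠ s in 𝓝 (0 : ℝ), |h s - h 0 - s * deriv h 0| ≤ K * s ^ 2 := by
  obtain ⟨K, t, ht, hK⟩ := hh.locallyLipschitz_deriv hk 0
  obtain ⟨ε, hε, hb⟩ := Metric.mem_nhds_iff.1 ht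
  have hd := (hh.contDiff_one hk).differentiable one_ne_zero
  refine ⟨K, ?_⟩
  filter_upwards [Metric.ball_mem_nhds (0 : ℝ) hε] with s hs
  have hs' : |s| < ε := by simpa using hs
  have hmem : ∀ y ∈ uIcc 0 s, |y| ≤ |s| := fun y hy => by
    simpa using abs_sub_left_of_mem_uIcc hy
  have hb' : ∀ y ∈ uIcc 0 s, y ∈ t := fun y hy => hb (by simpa using (hmem y hy).trans_lt hs')
  rcases eq_or_ne s 0 with rfl | hs0
  · simp
  have hK0 : 0 ≤ K := by
    have := (abs_nonneg _).trans (hK s (hb' s right_mem_uIcc) 0 (hb' 0 left_mem_uIcc))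
    rw [sub_zero] at this
    exact nonneg_of_mul_nonneg_left this (abs_pos.2 hs0)
  have := (convex_uIcc (0 : ℝ) s).norm_image_sub_le_of_norm_hasDerivWithin_le (C := K * |s|)
    (f := fun y => h y - y * deriv h 0) (f' := fun y => deriv h y - 1 * deriv h 0)
    (fun y _ => ((hd y).hasDerivAt.sub ((hasDerivAt_id y).mul_const _)).hasDerivWithinAt)
    (fun y hy => by
      have := hK y (hb' y hy) 0 (hb' 0 left_mem_uIcc)
      rw [sub_zero] at this
      rw [one_mul, Real.norm_eq_abs]
      exact this.trans (mul_le_mul_of_nonneg_left (hmem y hy) hK0))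
    left_mem_uIcc right_mem_uIcc
  rw [Real.norm_eq_abs, Real.norm_eq_abs, sub_zero, mul_assoc, abs_mul_abs_self] at this
  calc _ = |h s - s * deriv h 0 - (h 0 - 0 * deriv h 0)| := by ring_nf
    _ ≤ _ := by rw [sq]; exact this

theorem exists_plateau : ∃ β : ℝ → ℝ, ContDiff ℝ (⊤ : ℕ∞) β ∧ (∀ y, 1 ≤ |y| → β y = 0) ∧
    ∀ y, |y| ≤ 1 / 2 → β y = 1 := by
  let b : ContDiffBump (0 : ℝ) := ⟨1 / 2, 1, by norm_num, by norm_num⟩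
  refine ⟨b, b.contDiff, fun y hy => b.zero_of_le_dist ?_, fun y hy => b.one_of_mem_closedBall ?_⟩
  · simpa [b] using hy
  · simpa [b] using hy

theorem deriv_eq_of_eventuallyEq_affine {G F : ℝ → ℝ} {a b α t₀ : ℝ} (hF : Differentiable ℝ F)
    (h : G =ᶠ[𝓝 a] fun t => F (b + α * (t - t₀))) :
    deriv G a = α * deriv F (b + α * (a - t₀)) := by
  rw [h.deriv_eq]
  have h1 : HasDerivAt (fun t => b + α * (t - t₀)) (α * 1) a :=
    (((hasDerivAt_id a).sub_const t₀).const_mul α).const_add b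
  have := (hF (b + α * (a - t₀))).hasDerivAt.comp a h1
  rw [show (fun t => F (b + α * (t - t₀))) = F ∘ fun t => b + α * (t - t₀) from rfl, this.deriv]
  ring

/-! ### Chain rule along curves and linearity of directional derivatives. -/

variable {X : Type*} [AddCommGroup X] [Module ℝ X] {k : ℕ∞} {X' : Submodule ℝ (Module.Dual ℝ X)}

theorem mem_curves_iff {c : ℝ → X} :
    c ∈ (lipStructure k X').curves ↔ ∀ l ∈ X', LipOn k (fun t => l (c t)) univ :=
  ⟨fun h l hl => h l ⟨l, hl, rfl⟩, fun h f ⟨l, hl, hf⟩ => by rw [hf]; exact h l hl⟩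

theorem mem_curves_of_contDiff {c : ℝ → X}
    (h : ∀ l ∈ X', ContDiff ℝ (⊤ : ℕ∞) fun t => l (c t)) : c ∈ (lipStructure k X').curves :=
  mem_curves_iff.2 fun l hl => LipOn.of_contDiff (h l hl)

theorem line_mem_curves (x v : X) : (fun t : ℝ => x + t • v) ∈ (lipStructure k X').curves :=
  mem_curves_of_contDiff fun l _ => by
    simp only [map_add, map_smul, smul_eq_mul]
    exact contDiff_const.add (contDiff_id.mul contDiff_const)

variable {g : X → ℝ}

theorem contDiff_line (hk : k ≠ 0) (hg : g ∈ (lipStructure k X').functions) (x v : X) :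
    ContDiff ℝ 1 fun t : ℝ => g (x + t • v) :=
  LipOn.contDiff_one hk (hg _ (line_mem_curves x v))

theorem differentiable_line (hk : k ≠ 0) (hg : g ∈ (lipStructure k X').functions) (x v : X) :
    Differentiable ℝ fun t : ℝ => g (x + t • v) :=
  (contDiff_line hk hg x v).differentiable one_ne_zero

theorem exists_forall_abs_le_of_eventually {a : ℕ → ℝ} {M : ℝ} (h : ∀ᶠ n in atTop, |a n| ≤ M) :
    ∃ M, ∀ n, |a n| ≤ M := by
  have : IsBoundedUnder (· ≤ ·) atTop fun n => |a n| := ⟨M, by simpa using h⟩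
  obtain ⟨B, hB⟩ := this.bddAbove_range
  exact ⟨B, fun n => hB ⟨n, rfl⟩⟩

theorem tendsto_half_pow_add_two : Tendsto (fun n : ℕ => (1 / 2 : ℝ) ^ (n + 2)) atTop (𝓝 0) :=
  (tendsto_add_atTop_iff_nat 2).2
    (tendsto_pow_atTop_nhds_zero_of_lt_one (by norm_num) (by norm_num))

/-- A function that is differentiable along the curves has along each curve the derivative in the
direction of its weak derivative. -/
theorem deriv_comp_curve (hk : k ≠ 0) (hg : g ∈ (lipStructure k X').functions) {c : ℝ → X}
    (hc : c ∈ (lipStructure k X').curves) {v : X} (hv : IsWeakDerivAt X' c v 0) :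
    deriv (g ∘ c) 0 = deriv (fun t : ℝ => g (c 0 + t • v)) 0 := by
  obtain ⟨β, hβ, hβ0, hβ1⟩ := exists_plateau
  set x := c 0 with hx
  obtain ⟨τ, hτ⟩ : ∃ τ : ℕ → ℝ, τ = fun n => (1 / 2 : ℝ) ^ (n + 2) := ⟨_, rfl⟩
  have τpos : ∀ n, 0 < τ n := fun n => by rw [hτ]; positivity
  have τle : ∀ n, τ n ≤ 1 := fun n => by rw [hτ]; exact pow_le_one₀ (by norm_num) (by norm_num)
  have τlim : Tendsto τ atTop (𝓝 0) := hτ ▸ tendsto_half_pow_add_two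
  -- The bump of width `τ n` will be traversed with speed `s n / τ n = τ n ^ (n + 1)`; the spare
  -- factor `τ n` produces the limit `0` at the end.
  obtain ⟨s, hs⟩ : ∃ s : ℕ → ℝ, s = fun n => τ n ^ (n + 2) := ⟨_, rfl⟩
  have spos : ∀ n, 0 < s n := fun n => by rw [hs]; exact pow_pos (τpos n) _
  have sle : ∀ n, s n ≤ τ n := fun n => by
    rw [hs]; exact pow_le_of_le_one (τpos n).le (τle n) (by omega)
  have slim : Tendsto s atTop (𝓝 0) :=
    squeeze_zero (fun n => (spos n).le) sle τlim
  have slim' : Tendsto s atTop (𝓝[≠] 0) :=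
    tendsto_nhdsWithin_iff.2 ⟨slim, Eventually.of_forall fun n => (spos n).ne'⟩
  have sκ : ∀ n, |s n| ≤ τ n ^ n := fun n => by
    rw [abs_of_pos (spos n), hs]
    exact pow_le_pow_of_le_one (τpos n).le (τle n) (by omega)
  -- The second-order remainder of `c`, bounded under each `l ∈ X'` because `l ∘ c` has a locally
  -- Lipschitz derivative.
  obtain ⟨w, hw⟩ : ∃ w : ℕ → X, w = fun n => (s n ^ 2)⁻¹ • (c (s n) - x - s n • v) := ⟨_, rfl⟩
  have hwb : ∀ l ∈ X', ∃ M, ∀ n, |l (w n)| ≤ M := fun l hl => by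
    obtain ⟨K, hK⟩ := (mem_curves_iff.1 hc l hl).exists_abs_sub_le_sq hk
    rw [(hv l hl).deriv] at hK
    refine exists_forall_abs_le_of_eventually (M := K) ?_
    filter_upwards [slim.eventually hK] with n hn
    have h2 : 0 < s n ^ 2 := pow_pos (spos n) 2
    rw [hw]
    simp only [map_smul, map_sub, smul_eq_mul]
    rw [abs_mul, abs_inv, abs_of_pos h2, inv_mul_le_iff₀ h2, mul_comm (s n ^ 2)]
    exact hn
  have hF := fun n => differentiable_line hk hg (x + s n • v) (w n)
  -- Mean value theorem on the segment from `x + s n • v` to `c (s n)`.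
  have hmv : ∀ n, ∃ r ∈ Ioo 0 (s n ^ 2), deriv (fun r : ℝ => g (x + s n • v + r • w n)) r =
      (g (c (s n)) - g (x + s n • v)) / s n ^ 2 := fun n => by
    obtain ⟨r, hr, h⟩ := exists_deriv_eq_slope (fun r : ℝ => g (x + s n • v + r • w n))
      (pow_pos (spos n) 2) (hF n).continuous.continuousOn (hF n).differentiableOn
    refine ⟨r, hr, h.trans ?_⟩
    have h1 : x + s n • v + s n ^ 2 • w n = c (s n) := by
      rw [hw]
      simp only [smul_smul, mul_inv_cancel₀ (pow_pos (spos n) 2).ne', one_smul]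
      abel
    rw [h1, zero_smul, add_zero, sub_zero]
  choose r hr hrd using hmv
  -- Near `2⁻ⁿ` this curve is the affine path `x + s n • v + (r n + τ n ^ (n + 1) * (t - 2⁻ⁿ)) • w
  -- n`, passing at `2⁻ⁿ` through the mean value point.
  obtain ⟨e, he⟩ : ∃ e : ℝ → X, e = fun t => x +
      bumpSeries β s τ (fun n => v + (r n / s n) • w n) t +
      bumpSeries (fun y => y * β y) s τ w t := ⟨_, rfl⟩
  have hτ' : ∀ n, τ n ≤ (1 / 2) ^ (n + 2) := fun n => by rw [hτ]
  have hΘ0 : ∀ y : ℝ, 1 ≤ |y| → y * β y = 0 := fun y hy => by rw [hβ0 y hy, mul_zero]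
  have heC : e ∈ (lipStructure k X').curves := mem_curves_of_contDiff fun l hl => by
    simp only [he, map_add]
    refine (contDiff_const.add (contDiff_bumpSeries hβ0 τpos hτ' hβ sκ l ?_)).add
      (contDiff_bumpSeries hΘ0 τpos hτ' (contDiff_id.mul hβ) sκ l (hwb l hl))
    obtain ⟨M, hM⟩ := hwb l hl
    refine ⟨|l v| + M, fun n => ?_⟩
    rw [map_add, map_smul, smul_eq_mul]
    refine (abs_add_le _ _).trans (add_le_add le_rfl ?_)
    rw [abs_mul]
    refine (mul_le_of_le_one_left (abs_nonneg _) ?_).trans (hM n)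
    rw [abs_div, abs_of_pos (hr n).1, abs_of_pos (spos n), div_le_one (spos n)]
    refine (hr n).2.le.trans ?_
    exact pow_le_of_le_one (spos n).le ((sle n).trans (τle n)) two_ne_zero
  have hde : ∀ n, deriv (g ∘ e) ((1 / 2) ^ n) =
      τ n ^ (n + 1) * deriv (fun r : ℝ => g (x + s n • v + r • w n)) (r n) := fun n => by
    have h0 := τpos n
    have hev : g ∘ e =ᶠ[𝓝 ((1 / 2) ^ n)] fun t =>
        (fun r : ℝ => g (x + s n • v + r • w n)) (r n + τ n ^ (n + 1) * (t - (1 / 2) ^ n)) := by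
      filter_upwards [Metric.ball_mem_nhds ((1 / 2 : ℝ) ^ n) (half_pos h0)] with t ht
      rw [Metric.mem_ball, Real.dist_eq] at ht
      have ht' : |t - (1 / 2) ^ n| < (1 / 2) ^ (n + 2) := by
        refine (ht.trans (half_lt_self h0)).trans_le (hτ' n)
      have hb : β ((t - (1 / 2) ^ n) / τ n) = 1 := by
        refine hβ1 _ ?_
        rw [abs_div, abs_of_pos h0, div_le_iff₀ h0]
        linarith
      simp only [Function.comp_apply, he]
      rw [bumpSeries_eq hβ0 τpos hτ' ht', bumpSeries_eq hΘ0 τpos hτ' ht', hb, mul_one, mul_one,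
        smul_add, smul_smul, mul_div_cancel₀ _ (spos n).ne']
      have : s n * ((t - (1 / 2) ^ n) / τ n) = τ n ^ (n + 1) * (t - (1 / 2) ^ n) := by
        rw [hs]
        field_simp
        ring
      rw [this, add_smul]
      congr 1
      abel
    rw [deriv_eq_of_eventuallyEq_affine (hF n) hev, sub_self, mul_zero, add_zero]
  have hcont : Tendsto (fun n : ℕ => deriv (g ∘ e) ((1 / 2) ^ n)) atTop (𝓝 (deriv (g ∘ e) 0)) :=
    (((LipOn.contDiff_one hk (hg e heC)).continuous_deriv le_rfl).tendsto 0).comp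
      (tendsto_pow_atTop_nhds_zero_of_lt_one (by norm_num) (by norm_num))
  -- `τ n * (g ∘ e)' (2⁻ⁿ)` equals `(g (c (s n)) - g (x + s n • v)) / s n`, the difference of the
  -- two difference quotients, and it tends to `0`.
  have hlim := τlim.mul hcont
  rw [zero_mul] at hlim
  have hlim1 := ((LipOn.contDiff_one hk (hg c hc)).differentiable one_ne_zero
    0).hasDerivAt.tendsto_slope_zero.comp slim'
  have hlim2 := ((differentiable_line hk hg x v) 0).hasDerivAt.tendsto_slope_zero.comp slim'
  refine sub_eq_zero.1 (tendsto_nhds_unique (hlim1.sub hlim2) (hlim.congr fun n => ?_))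
  rw [hde, hrd]
  simp only [Function.comp_apply, zero_add, smul_eq_mul, zero_smul, add_zero, ← hx]
  have h0 := (spos n).ne'
  have h1 : τ n * τ n ^ (n + 1) = s n := by rw [hs]; ring
  rw [← mul_assoc, h1]
  field_simp
  ring

/-- By the mean value theorem, the quotient from `x + r • v` to `x + r • (v + w)` is a derivative in
direction `w` based at `x + r • v`. It must be compared with one based at `x`. A single curve moves
in direction `w` and switches the small offset `r n • v` on over a very short time; the Lipschitz
bound on the derivative of `g` along it makes the two derivatives agree in the limit. -/
theorem deriv_line_add (hk : k ≠ 0) (hg : g ∈ (lipStructure k X').functions) (x v w : X) :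
    deriv (fun t : ℝ => g (x + t • (v + w))) 0 =
      deriv (fun t : ℝ => g (x + t • v)) 0 + deriv (fun t : ℝ => g (x + t • w)) 0 := by
  obtain ⟨β, hβ, hβ0, hβ1⟩ := exists_plateau
  obtain ⟨τ, hτ⟩ : ∃ τ : ℕ → ℝ, τ = fun n => (1 / 2 : ℝ) ^ (n + 2) := ⟨_, rfl⟩
  have τpos : ∀ n, 0 < τ n := fun n => by rw [hτ]; positivity
  have τle4 : ∀ n, τ n ≤ 1 / 4 := fun n => by
    have : τ n ≤ (1 / 2) ^ 2 := by
      rw [hτ]; exact pow_le_pow_of_le_one (by norm_num) (by norm_num) (by omega)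
    linarith
  have τle : ∀ n, τ n ≤ 1 := fun n => (τle4 n).trans (by norm_num)
  have τlim : Tendsto τ atTop (𝓝 0) := hτ ▸ tendsto_half_pow_add_two
  have hτ' : ∀ n, τ n ≤ (1 / 2) ^ (n + 2) := fun n => by rw [hτ]
  -- Two scales: `τ n` is the width of the motion along `w`, and `ρ n` that of the offset along `v`.
  -- The ratio of `ρ n` to the speed `τ n ^ (n + 1)` is `τ n`, which tends to `0`.
  obtain ⟨ρ, hρ⟩ : ∃ ρ : ℕ → ℝ, ρ = fun n => τ n ^ (n + 2) := ⟨_, rfl⟩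
  have ρpos : ∀ n, 0 < ρ n := fun n => by rw [hρ]; exact pow_pos (τpos n) _
  have ρle : ∀ n, ρ n ≤ τ n * (1 / 4) := fun n => by
    have h1 : ρ n ≤ τ n ^ 2 := by
      rw [hρ]; exact pow_le_pow_of_le_one (τpos n).le (τle n) (by omega)
    nlinarith [τpos n, τle4 n]
  have ρle' : ∀ n, ρ n ≤ τ n := fun n => by linarith [ρle n, τpos n]
  have ρκ : ∀ n, |ρ n| ≤ τ n ^ n := fun n => by
    rw [abs_of_pos (ρpos n), hρ]
    exact pow_le_pow_of_le_one (τpos n).le (τle n) (by omega)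
  obtain ⟨r, hr⟩ : ∃ r : ℕ → ℝ, r = fun n => ρ n ^ (n + 1) := ⟨_, rfl⟩
  have rpos : ∀ n, 0 < r n := fun n => by rw [hr]; exact pow_pos (ρpos n) _
  have rle : ∀ n, r n ≤ ρ n := fun n => by
    rw [hr]; exact pow_le_of_le_one (ρpos n).le ((ρle' n).trans (τle n)) (by omega)
  have rκ : ∀ n, |r n| ≤ ρ n ^ n := fun n => by
    rw [abs_of_pos (rpos n), hr]
    exact pow_le_pow_of_le_one (ρpos n).le ((ρle' n).trans (τle n)) (by omega)
  have rlim : Tendsto r atTop (𝓝 0) :=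
    squeeze_zero (fun n => (rpos n).le) (fun n => (rle n).trans (ρle' n)) τlim
  have rlim' : Tendsto r atTop (𝓝[≠] 0) :=
    tendsto_nhdsWithin_iff.2 ⟨rlim, Eventually.of_forall fun n => (rpos n).ne'⟩
  have hF := fun n => differentiable_line hk hg (x + r n • v) w
  have hF0 := contDiff_line hk hg x w
  have hmv : ∀ n, ∃ θ ∈ Ioo 0 (r n), deriv (fun t : ℝ => g (x + r n • v + t • w)) θ =
      (g (x + r n • (v + w)) - g (x + r n • v)) / r n := fun n => by
    obtain ⟨θ, hθ, h⟩ := exists_deriv_eq_slope (fun t : ℝ => g (x + r n • v + t • w))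
      (rpos n) (hF n).continuous.continuousOn (hF n).differentiableOn
    refine ⟨θ, hθ, h.trans ?_⟩
    rw [zero_smul, add_zero, sub_zero, smul_add, add_assoc]
  choose θ hθ hθd using hmv
  have θκ : ∀ n, |θ n| ≤ τ n ^ n := fun n => by
    rw [abs_of_pos (hθ n).1]
    exact (hθ n).2.le.trans ((rle n).trans ((le_abs_self _).trans (ρκ n)))
  obtain ⟨e, he⟩ : ∃ e : ℝ → X, e = fun t => x +
      bumpSeries β θ τ (fun _ => w) t + bumpSeries (fun y => y * β y) ρ τ (fun _ => w) t +
      bumpSeries β r ρ (fun _ => v) t := ⟨_, rfl⟩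
  have hΘ0 : ∀ y : ℝ, 1 ≤ |y| → y * β y = 0 := fun y hy => by rw [hβ0 y hy, mul_zero]
  have heC : e ∈ (lipStructure k X').curves := mem_curves_of_contDiff fun l hl => by
    simp only [he, map_add]
    exact ((contDiff_const.add
      (contDiff_bumpSeries hβ0 τpos hτ' hβ θκ l ⟨_, fun _ => le_rfl⟩)).add
      (contDiff_bumpSeries hΘ0 τpos hτ' (contDiff_id.mul hβ) ρκ l ⟨_, fun _ => le_rfl⟩)).add
      (contDiff_bumpSeries hβ0 ρpos (fun n => (ρle' n).trans (hτ' n)) hβ rκ l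
        ⟨_, fun _ => le_rfl⟩)
  have hev : ∀ n t, |t - (1 / 2) ^ n| < τ n / 2 → e t = x +
      (r n * β ((t - (1 / 2) ^ n) / ρ n)) • v +
      (θ n + τ n ^ (n + 1) * (t - (1 / 2) ^ n)) • w := fun n t ht => by
    have h0 := τpos n
    have ht' : |t - (1 / 2) ^ n| < (1 / 2) ^ (n + 2) :=
      (ht.trans (half_lt_self h0)).trans_le (hτ' n)
    have hb : β ((t - (1 / 2) ^ n) / τ n) = 1 := by
      refine hβ1 _ ?_
      rw [abs_div, abs_of_pos h0, div_le_iff₀ h0]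
      linarith
    simp only [he]
    rw [bumpSeries_eq hβ0 τpos hτ' ht', bumpSeries_eq hΘ0 τpos hτ' ht',
      bumpSeries_eq hβ0 ρpos (fun n => (ρle' n).trans (hτ' n)) ht', hb, mul_one, mul_one]
    have : ρ n * ((t - (1 / 2) ^ n) / τ n) = τ n ^ (n + 1) * (t - (1 / 2) ^ n) := by
      rw [hρ]
      field_simp
      ring
    rw [this, add_smul]
    abel
  have hd1 : ∀ n, deriv (g ∘ e) ((1 / 2) ^ n) =
      τ n ^ (n + 1) * deriv (fun t : ℝ => g (x + r n • v + t • w)) (θ n) := fun n => by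
    have h0 := ρpos n
    have : g ∘ e =ᶠ[𝓝 ((1 / 2) ^ n)] fun t =>
        (fun t : ℝ => g (x + r n • v + t • w)) (θ n + τ n ^ (n + 1) * (t - (1 / 2) ^ n)) := by
      filter_upwards [Metric.ball_mem_nhds ((1 / 2 : ℝ) ^ n) (half_pos h0)] with t ht
      rw [Metric.mem_ball, Real.dist_eq] at ht
      rw [Function.comp_apply, hev n t (by linarith [ρle' n]), hβ1, mul_one]
      rw [abs_div, abs_of_pos h0, div_le_iff₀ h0]
      linarith
    rw [deriv_eq_of_eventuallyEq_affine (hF n) this, sub_self, mul_zero, add_zero]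
  -- Within `ρ n / 2` of this point the offset bump vanishes, while the motion along `w` is still
  -- affine because `2 * ρ n ≤ τ n / 2`.
  have hd2 : ∀ n, deriv (g ∘ e) ((1 / 2) ^ n - 3 / 2 * ρ n) = τ n ^ (n + 1) *
      deriv (fun t : ℝ => g (x + t • w)) (θ n + τ n ^ (n + 1) * (-(3 / 2 * ρ n))) := fun n => by
    have h0 := ρpos n
    have : g ∘ e =ᶠ[𝓝 ((1 / 2) ^ n - 3 / 2 * ρ n)] fun t =>
        (fun t : ℝ => g (x + t • w)) (θ n + τ n ^ (n + 1) * (t - (1 / 2) ^ n)) := by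
      filter_upwards [Metric.ball_mem_nhds ((1 / 2 : ℝ) ^ n - 3 / 2 * ρ n) (half_pos h0)]
        with t ht
      rw [Metric.mem_ball, Real.dist_eq, abs_lt] at ht
      have hneg : t - (1 / 2) ^ n < 0 := by linarith [ht.2]
      rw [Function.comp_apply, hev n t, hβ0, mul_zero, zero_smul, add_zero]
      · rw [abs_div, abs_of_pos h0, one_le_div h0, abs_of_neg hneg]
        linarith [ht.2]
      · rw [abs_of_neg hneg]
        linarith [ht.1, ρle n]
    rw [deriv_eq_of_eventuallyEq_affine hF0.differentiable_one this, sub_sub_cancel_left]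
  obtain ⟨K, U, hU, hK⟩ := LipOn.locallyLipschitz_deriv hk (hg e heC) 0
  have ρlim : Tendsto ρ atTop (𝓝 0) := squeeze_zero (fun n => (ρpos n).le) ρle' τlim
  have hlim1 : Tendsto (fun n : ℕ => (1 / 2 : ℝ) ^ n) atTop (𝓝 0) :=
    tendsto_pow_atTop_nhds_zero_of_lt_one (by norm_num) (by norm_num)
  have hlim2 : Tendsto (fun n : ℕ => (1 / 2 : ℝ) ^ n - 3 / 2 * ρ n) atTop (𝓝 0) := by
    simpa using hlim1.sub (ρlim.const_mul (3 / 2))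
  -- The Lipschitz bound over the time gap `3 / 2 * ρ n`, divided by the speed `τ n ^ (n + 1)`, is
  -- `K * (3 / 2) * τ n`.
  have hdiff : Tendsto (fun n => deriv (fun t : ℝ => g (x + r n • v + t • w)) (θ n) -
      deriv (fun t : ℝ => g (x + t • w)) (θ n + τ n ^ (n + 1) * (-(3 / 2 * ρ n)))) atTop
      (𝓝 0) := by
    have hK' : Tendsto (fun n => K * (3 / 2) * τ n) atTop (𝓝 0) := by
      simpa using τlim.const_mul (K * (3 / 2))
    refine squeeze_zero_norm' ?_ hK'
    filter_upwards [hlim1.eventually_mem hU, hlim2.eventually_mem hU] with n h1 h2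
    have := hK _ h1 _ h2
    have hpos : 0 < τ n ^ (n + 1) := pow_pos (τpos n) _
    rw [hd1, hd2, ← mul_sub, abs_mul, sub_sub_cancel, abs_of_pos hpos,
      abs_of_pos (by linarith [ρpos n] : 0 < 3 / 2 * ρ n)] at this
    have hρτ : ρ n = τ n ^ (n + 1) * τ n := by rw [hρ]; ring
    rw [Real.norm_eq_abs]
    refine le_of_mul_le_mul_left (this.trans_eq ?_) hpos
    rw [hρτ]
    ring
  have hθlim : Tendsto (fun n => θ n + τ n ^ (n + 1) * (-(3 / 2 * ρ n))) atTop (𝓝 0) := by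
    have h1 : Tendsto θ atTop (𝓝 0) :=
      squeeze_zero (fun n => (hθ n).1.le) (fun n => (hθ n).2.le) rlim
    have h2 : Tendsto (fun n => τ n ^ (n + 1)) atTop (𝓝 0) :=
      squeeze_zero (fun n => (pow_pos (τpos n) _).le)
        (fun n => pow_le_of_le_one (τpos n).le (τle n) (by omega)) τlim
    simpa using h1.add (h2.mul (ρlim.const_mul (3 / 2)).neg)
  have hlim3 := hdiff.add (((hF0.continuous_deriv le_rfl).tendsto 0).comp hθlim)
  have hlim4 := ((differentiable_line hk hg x (v + w)) 0).hasDerivAt.tendsto_slope_zero.comp rlim'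
  have hlim5 := ((differentiable_line hk hg x v) 0).hasDerivAt.tendsto_slope_zero.comp rlim'
  rw [zero_add] at hlim3
  refine sub_eq_iff_eq_add'.1 (tendsto_nhds_unique (hlim4.sub hlim5) (hlim3.congr fun n => ?_))
  simp only [Function.comp_apply, zero_add, smul_eq_mul, zero_smul, add_zero, sub_add_cancel]
  rw [hθd]
  ring

/-- The derivative at `x` of a structure function, as a linear form. -/
noncomputable def directionalDeriv (hk : k ≠ 0) (hg : g ∈ (lipStructure k X').functions) (x : X) :
    Module.Dual ℝ X where
  toFun v := deriv (fun t : ℝ => g (x + t • v)) 0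
  map_add' v w := deriv_line_add hk hg x v w
  map_smul' a v := by
    have := deriv_comp_mul_left a (fun t : ℝ => g (x + t • v)) 0
    simp only [mul_zero] at this
    rw [RingHom.id_apply, ← this]
    congr 1
    funext t
    rw [smul_smul, mul_comm]

end DirectionalDerivatives
-- Plaques, their differentials and the tangent maps.
section Plaques

open LipDiffeology

variable {X Y : Type*} [AddCommGroup X] [Module ℝ X] [AddCommGroup Y] [Module ℝ Y] {k : ℕ∞}
  {X' : Submodule ℝ (Module.Dual ℝ X)} {Y' : Submodule ℝ (Module.Dual ℝ Y)}

theorem morphisms_eq_maps : (diffeology k X').morphisms (diffeology k Y') =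
    (lipStructure k X').maps (lipStructure k Y') := by
  refine Subset.antisymm (fun f hf c hc => mem_curves_iff.2 fun l hl => ?_)
    fun f hf n U p hp => ⟨hp.1, fun g hg => hp.2 (g ∘ f) fun c hc => hg _ (hf c hc)⟩
  -- The curve viewed as a 1-plaque; it is recovered below by composing with `t ↦ t • e₀`.
  have hp : (diffeology k X').IsPlaque (univ : Set (Euc 1)) fun y => c (y 0) :=
    ⟨isOpen_univ, fun g hg => LipOn.comp (g := g ∘ c) (f := fun y : Euc 1 => y 0) isOpen_univ
      isOpen_univ (hg c hc) (LipOn.of_contDiff (contDiff_euclidean.1 contDiff_id 0))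
      (mapsTo_univ _ _)⟩
  have h1 := (hf 1 univ _ hp).2 l fun d hd => hd l ⟨l, hl, rfl⟩
  have h2 : LipOn k (fun t : ℝ => t • (EuclideanSpace.single 0 1 : Euc 1)) univ :=
    LipOn.of_contDiff (contDiff_id.smul contDiff_const)
  refine (LipOn.comp isOpen_univ isOpen_univ h1 h2 (mapsTo_univ _ _)).congr isOpen_univ
    fun t _ => ?_
  simp

/-- Every direction at the base point of a plaque is represented by a curve. -/
theorem exists_curve_of_plaque (hk : k ≠ 0) {n : ℕ} {x : X} (p : (diffeology k X').PlaqueAt n x)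
    (ξ : Euc n) : ∃ c ∈ (lipStructure k X').curves, c 0 = x ∧
      ∀ f ∈ (lipStructure k X').functions,
        HasDerivAt (f ∘ c) (fderiv ℝ (f ∘ p.toFun) 0 ξ) 0 := by
  have hU : IsOpen p.dom := p.isPlaque.1
  obtain ⟨δ, hδ, hb⟩ := Metric.mem_nhds_iff.1
    ((hU.preimage (continuous_id.smul continuous_const : Continuous fun t : ℝ => t • ξ)).mem_nhds
      (x := 0) (by simpa using p.zero_mem))
  let b : ContDiffBump (0 : ℝ) := ⟨δ / 2, δ, by linarith, by linarith⟩
  -- The bump keeps the ray inside the domain for all `t` without changing it near `0`.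
  have hbU : MapsTo (fun t : ℝ => (t * b t) • ξ) univ p.dom := fun t _ => by
    by_cases ht : dist t 0 < δ
    · refine hb (a := t * b t) ?_
      rw [Metric.mem_ball, Real.dist_eq, sub_zero] at *
      rw [abs_mul, abs_of_nonneg b.nonneg]
      exact (mul_le_of_le_one_right (abs_nonneg _) b.le_one).trans_lt ht
    · have : b t = 0 := b.zero_of_le_dist (not_lt.1 ht)
      simpa [this] using p.zero_mem
  have hbs : ContDiff ℝ (⊤ : ℕ∞) fun t : ℝ => (t * b t) • ξ :=
    (contDiff_id.mul b.contDiff).smul contDiff_const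
  have hbd : HasDerivAt (fun t : ℝ => (t * b t) • ξ) ξ 0 := by
    have h := (hasDerivAt_id (0 : ℝ)).smul_const ξ
    rw [one_smul] at h
    refine h.congr_of_eventuallyEq ?_
    filter_upwards [b.eventuallyEq_one] with t ht
    rw [ht, Pi.one_apply, mul_one, id]
  refine ⟨fun t => p.toFun ((t * b t) • ξ), fun f hf => ?_, by simp [p.map_zero], fun f hf => ?_⟩
  · exact LipOn.comp (g := f ∘ p.toFun) hU isOpen_univ (p.isPlaque.2 f fun c hc => hc f hf)
      (LipOn.of_contDiff hbs) hbU
  · have h1 : DifferentiableAt ℝ (f ∘ p.toFun) 0 :=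
      ((p.isPlaque.2 f hf).1.contDiffAt (hU.mem_nhds p.zero_mem)).differentiableAt
        (by exact_mod_cast hk)
    have h2 : HasFDerivAt (f ∘ p.toFun) (fderiv ℝ (f ∘ p.toFun) 0) (((0 : ℝ) * b 0) • ξ) := by
      simpa using h1.hasFDerivAt
    exact h2.comp_hasDerivAt 0 hbd

theorem dual_mem_functions {l : Module.Dual ℝ X} (hl : l ∈ X') :
    ⇑l ∈ (lipStructure k X').functions := fun _ hc => hc l ⟨l, hl, rfl⟩

/-- The differentials at the base point of a plaque are represented by a linear map into the
space itself. -/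
theorem exists_linearMap_of_plaque (hk : k ≠ 0)
    (hX : ∀ c ∈ (lipStructure k X').curves, ∀ t : ℝ, ∃ v : X, IsWeakDerivAt X' c v t)
    {n : ℕ} {x : X} (p : (diffeology k X').PlaqueAt n x) :
    ∃ A : Euc n →ₗ[ℝ] X, ∀ g : X → ℝ, ∀ hg : g ∈ (lipStructure k X').functions,
      (fderiv ℝ (g ∘ p.toFun) 0 : Euc n →ₗ[ℝ] ℝ) = directionalDeriv hk hg x ∘ₗ A := by
  have key : ∀ ξ : Euc n, ∃ v : X, ∀ g : X → ℝ, ∀ hg : g ∈ (lipStructure k X').functions,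
      fderiv ℝ (g ∘ p.toFun) 0 ξ = directionalDeriv hk hg x v := fun ξ => by
    obtain ⟨c, hc, rfl, hcd⟩ := exists_curve_of_plaque hk p ξ
    obtain ⟨v, hv⟩ := hX c hc 0
    exact ⟨v, fun g hg => (hcd g hg).deriv.symm.trans (deriv_comp_curve hk hg hc hv)⟩
  choose v hv using key
  let B := (EuclideanSpace.basisFun (Fin n) ℝ).toBasis
  -- The chosen `v ξ` need not be linear in `ξ`. Only its values on a basis are kept, which suffices
  -- because both sides are linear forms.
  refine ⟨B.constr ℝ fun i => v (B i), fun g hg => B.ext fun i => ?_⟩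
  rw [LinearMap.comp_apply, B.constr_basis]
  exact hv (B i) g hg

theorem directionalDeriv_dual (hk : k ≠ 0) {l : Module.Dual ℝ X}
    (hl : ⇑l ∈ (lipStructure k X').functions) (x : X) : directionalDeriv hk hl x = l := by
  ext v
  have h : HasDerivAt (fun t : ℝ => l (x + t • v)) (1 * l v) 0 := by
    simp only [map_add, map_smul, smul_eq_mul]
    exact ((hasDerivAt_id (0 : ℝ)).mul_const (l v)).const_add (l x)
  exact h.deriv.trans (one_mul _)

/-- The family of linear forms on `ℝⁿ` obtained by composing a linear map into `X` with a family of
linear forms on `X`. -/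
noncomputable def composeForms {ι : Type*} (n : ℕ) (φ : ι → Module.Dual ℝ X) :
    (Euc n →ₗ[ℝ] X) →ₗ[ℝ] (ι → (Euc n →L[ℝ] ℝ)) :=
  LinearMap.pi fun i => LinearMap.toContinuousLinearMap.toLinearMap ∘ₗ (φ i).compRight ℝ

theorem composeForms_apply {ι : Type*} {n : ℕ} (φ : ι → Module.Dual ℝ X) (A : Euc n →ₗ[ℝ] X)
    (i : ι) (ξ : Euc n) : composeForms n φ A i ξ = φ i (A ξ) := rfl

/-- Such a `v` and `0` are both weak derivatives of the constant curve `0`. -/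
theorem eq_zero_of_forall_dual (hX : IsConvenient k X') {v : X} (h : ∀ l ∈ X', l v = 0) :
    v = 0 := by
  have hc : (fun _ : ℝ => (0 : X)) ∈ (lipStructure k X').curves :=
    mem_curves_of_contDiff fun l _ => contDiff_const
  refine hX.separated _ hc 0 v 0 (fun l hl => ?_) fun l _ => ?_
  · rw [h l hl]
    exact hasDerivAt_const _ _
  · rw [map_zero]
    exact hasDerivAt_const _ _

/-- The differentials of a plaque determine linearly those of its image under an `M`-map. -/
theorem exists_linearMap_differentials (hX : IsConvenient k X') {f : X → Y}
    (hf : f ∈ (diffeology k X').morphisms (diffeology k Y')) {n : ℕ} (hn : (n : ℕ∞) ≤ k) (x : X) :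
    ∃ L : (dualFunctions X' → (Euc n →L[ℝ] ℝ)) →ₗ[ℝ] (dualFunctions Y' → (Euc n →L[ℝ] ℝ)),
      ∀ p : (diffeology k X').PlaqueAt n x,
        L (differentials (dualFunctions X') p) = differentials (dualFunctions Y') (p.map hf) := by
  rcases Nat.eq_zero_or_pos n with rfl | hn0
  · refine ⟨0, fun p => funext fun l => ContinuousLinearMap.ext fun ξ => ?_⟩
    rw [Subsingleton.elim ξ 0, map_zero, map_zero]
  have hk : k ≠ 0 := by
    rintro rfl
    exact hn0.ne' (by simpa using hn)
  have hfM := hf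
  rw [morphisms_eq_maps] at hfM
  have hφ : ∀ g : dualFunctions Y', g.1 ∘ f ∈ (lipStructure k X').functions := fun g c hc =>
    hfM c hc g.1 g.2
  let J := composeForms n fun l : dualFunctions X' => l.2.choose
  let K := composeForms n fun g : dualFunctions Y' => directionalDeriv hk (hφ g) x
  -- Separatedness says that `X'` separates points, so `A` is determined by the forms `l ∘ A`. A
  -- linear left inverse `J'` then recovers `A` from the differentials of the plaque.
  have hJ : LinearMap.ker J = ⊥ := by
    refine LinearMap.ker_eq_bot'.2 fun A hA => LinearMap.ext fun ξ => ?_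
    refine eq_zero_of_forall_dual hX fun l hl => ?_
    have hlm : (⇑l : X → ℝ) ∈ dualFunctions X' := ⟨l, hl, rfl⟩
    have h1 : J A ⟨l, hlm⟩ ξ = 0 := by rw [hA]; rfl
    rw [composeForms_apply] at h1
    rw [← h1]
    exact congrFun hlm.choose_spec.2 _
  obtain ⟨J', hJ'⟩ := J.exists_leftInverse_of_injective hJ
  refine ⟨K ∘ₗ J', fun p => ?_⟩
  obtain ⟨A, hA⟩ := exists_linearMap_of_plaque hk hX.complete p
  have h1 : differentials (dualFunctions X') p = J A := by
    refine funext fun l => ContinuousLinearMap.ext fun ξ => ?_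
    have hl := l.2.choose_spec
    have hl' := dual_mem_functions (k := k) hl.1
    have := LinearMap.congr_fun (hA _ hl') ξ
    rw [directionalDeriv_dual] at this
    rw [← hl.2] at this
    exact this
  have h2 : differentials (dualFunctions Y') (p.map hf) = K A := by
    refine funext fun g => ContinuousLinearMap.ext fun ξ => ?_
    exact LinearMap.congr_fun (hA _ (hφ g)) ξ
  rw [h1, h2, LinearMap.comp_apply, ← LinearMap.comp_apply J', hJ', LinearMap.id_apply]

theorem morphisms_eq_cMaps (hX : IsConvenient k X') :
    (diffeology k X').morphisms (diffeology k Y') =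
      cMaps (dualFunctions_subset k X') (dualFunctions_subset k Y') := by
  refine Subset.antisymm (fun f hf => ?_) fun f hf => hf.1.1
  refine ⟨⟨hf, fun n hn x p q h => ?_⟩, fun n hn x => ?_⟩
  · obtain ⟨L, hL⟩ := exists_linearMap_differentials hX hf hn x
    exact (hL p).symm.trans ((congrArg L h).trans (hL q))
  · obtain ⟨L, hL⟩ := exists_linearMap_differentials hX hf hn x
    exact ⟨L, fun t => Quotient.inductionOn t hL⟩

end Plaques
end TangentDiffeology

theorem mainTheorem5 {X Y : Type*} [AddCommGroup X] [Module ℝ X] [AddCommGroup Y] [Module ℝ Y]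
    (k : ℕ∞) (X' : Submodule ℝ (Module.Dual ℝ X)) (Y' : Submodule ℝ (Module.Dual ℝ Y))
    (hX : TangentDiffeology.IsConvenient k X') (hY : TangentDiffeology.IsConvenient k Y') :
    (TangentDiffeology.diffeology k X').morphisms (TangentDiffeology.diffeology k Y') =
      (TangentDiffeology.lipStructure k X').maps (TangentDiffeology.lipStructure k Y') ∧
    (TangentDiffeology.lipStructure k X').maps (TangentDiffeology.lipStructure k Y') =
      TangentDiffeology.cMaps (TangentDiffeology.dualFunctions_subset k X')
        (TangentDiffeology.dualFunctions_subset k Y') :=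
  ⟨TangentDiffeology.morphisms_eq_maps, TangentDiffeology.morphisms_eq_maps.symm.trans
    (TangentDiffeology.morphisms_eq_cMaps hX)⟩
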